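/- Let $A\in\mathbb N$, let $m_1,\dots,m_A>0$ be masses, and let $M>0$ be a reference mass (for particles of equal mass $m_a=M$ all the weights $M/m_a$ below are $1$). Let $V:\mathbb R^{3A}\to\mathbb R$ be a local many-body potential: $V$ is locally integrable and $V(x_1,\dots,x_A)=\sum_{\emptyset\ne s\subseteq\{1,\dots,A\}}V_s\big((x_b)_{b\in s}\big)$, where each $V_s$ is real-valued and decays exponentially with the largest separation among its arguments (some of the $V_s$ may vanish; one-element sets $s$ give external potentials). Let $$H=-\sum_{a=1}^A\frac1{2m_a}\nabla_a^2+V ,\qquad E\in\mathbb R .$$ For a $C^1$ function $u:\mathbb R^{3A}\to\mathbb C$, $(E-H)u$ is understood in the sense of distributions. Let $\xi$ be a bounded $C^1$ function with $(E-H)\xi=0$, let $\psi$ be a $C^1$ function with $(E-H)\psi=0$ (the exact state), let $\tilde\psi$ be a $C^1$ function for which $(E-H)\tilde\psi$ is an integrable function (the approximate state), and let $\phi=\tilde\psi-\psi$. No square-integrability is required, and no particular asymptotic form of $\psi$, $\tilde\psi$ is needed; in particular they may be scattering states with the same ingoing wave. For $R>0$ and positions $y=(x_b)_{b\neq a}\in\mathbb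 R^{3(A-1)}$ of the other particles put $$S_a(R,y)=\oint_{|x_a|=R}\big(\xi^*\nabla_a\phi-(\nabla_a\xi^*)\,\phi\big)\cdot\hat n\,dS(x_a).$$ Then the following hold. 1. The total boundary term at infinity exists: the limit $$L=\lim_{R\to\infty}\ \sum_{a=1}^A\frac{M}{m_a}\int_{\{y\,:\,|x_b|<R\ \text{for all } b\ne a\}}S_a(R,y)\,dy$$ exists in $\mathbb C$, and $$|L|\le 2M\,\|\xi\|_\infty\,\|(E-H)\tilde\psi\|_1 .$$ 2. Suppose that for every $a$ the limit $\lim_{R\to\infty}S_a(R,y)$ exists for almost every $y$, and that there is an integrable function $h_a$ on $\mathbb R^{3(A-1)}$ such that for all sufficiently large $R$ one has $|S_a(R,y)|\le h_a(y)$ for almost every $y$ with $|x_b|<R$ for all $b\neq a$. Then each function $y\mapsto\lim_{R\to\infty}S_a(R,y)$ is integrable, $L$ is the sum of the iterated terms, $L=\sum_{a}\frac{M}{m_a}\int_{\mathbb R^{3(A-1)}}\lim_{R\to\infty}S_a(R,y)\,dy$, and therefore $$\Big|\sum_{a=1}^A\frac{M}{m_a}\int_{\mathbb R^{3(A-1)}}\lim_{R\to\infty}\oint_{|x_a|=R}\big(\xi^*\nabla_a\phi-(\nabla_a\xi^*)\,\phi\big)\cdot\hat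 n\,dS\,dy\Big|\le 2M\,\|\xi\|_\infty\,\|(E-H)\tilde\psi\|_1 .$$ -/

import Mathlib

open Filter Topology MeasureTheory
open scoped ContDiff ComplexConjugate

noncomputable section

namespace ManyBody

/-- Physical space `ℝ³` with its Euclidean norm. -/
abbrev Space : Type := EuclideanSpace ℝ (Fin 3)

/-- Configurations `x = (x₁, …, x_A)` of `A` particles, i.e. points of `ℝ^{3A}`
(with Lebesgue measure). -/
abbrev Config (A : ℕ) : Type := Fin A → Space

/-- Positions of all the particles except particle `a`, i.e. points of `ℝ^{3(A-1)}`. -/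
abbrev Others {A : ℕ} (a : Fin A) : Type := {b : Fin A // b ≠ a} → Space

/-- The configuration in which particle `a` sits at `p` and the others are placed as in `y`. -/
def place {A : ℕ} (a : Fin A) (p : Space) (y : Others a) : Config A :=
  fun b => if h : b = a then p else y ⟨b, h⟩

/-- The directional derivative `v · ∇ₐ f (x)` with respect to the position of particle `a`. -/
def partialDeriv {A : ℕ} (a : Fin A) (v : Space) (f : Config A → ℂ) (x : Config A) : ℂ :=
  fderiv ℝ f x (Pi.single a v)

/-- `∇ₐ f (x) · ∇ₐ h (x)`, the bilinear (not sesquilinear) product of complex gradients. -/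
def gradDot {A : ℕ} (a : Fin A) (f h : Config A → ℂ) (x : Config A) : ℂ :=
  ∑ j : Fin 3, partialDeriv a (EuclideanSpace.single j 1) f x *
    partialDeriv a (EuclideanSpace.single j 1) h x

/-- Local many-body potentials: real, locally integrable, and a sum over nonempty sets `s` of
particles of terms that depend only on the positions of the particles in `s` and decay
exponentially with the largest separation among these positions.  Terms with `s` a singleton
are external (one-body) potentials; any of the terms may vanish. -/
structure IsLocalPotential {A : ℕ} (V : Config A → ℝ) : Prop where
  locallyIntegrable : LocallyIntegrable V volume
  decomposition : ∃ U : (s : Finset (Fin A)) → (s → Space) → ℝ,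
    (∀ x : Config A, V x = ∑ s : Finset (Fin A) with s.Nonempty, U s (fun b => x b)) ∧
    ∀ s : Finset (Fin A), s.Nonempty → ∃ C ℓ r : ℝ, 0 < ℓ ∧ ∀ y : s → Space,
      r ≤ Metric.diam (Set.range y) →
        |U s y| ≤ C * Real.exp (-(Metric.diam (Set.range y)) / ℓ)

/-- `(E - H) ψ = g` in the sense of distributions, for a `C¹` wavefunction `ψ` and
`H = -∑ₐ (1 / (2 mₐ)) ∇ₐ² + V`: both sides agree when tested against every `η ∈ C_c^∞`, one
derivative of `∇ₐ² ψ` being moved to `η`. -/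
def IsSchrodingerViolation {A : ℕ} (m : Fin A → ℝ) (V : Config A → ℝ) (E : ℝ)
    (ψ g : Config A → ℂ) : Prop :=
  ContDiff ℝ 1 ψ ∧ LocallyIntegrable g volume ∧
    ∀ η : Config A → ℂ, ContDiff ℝ ∞ η → HasCompactSupport η →
      ∫ x, (((E - V x : ℝ) : ℂ) * ψ x * η x
          - ∑ a : Fin A, ((1 / (2 * m a) : ℝ) : ℂ) * gradDot a ψ η x)
        = ∫ x, g x * η x

/-- `ψ` is a `C¹` (generalized, not necessarily square-integrable) eigenfunction:
`(E - H) ψ = 0`. -/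
def IsEigenstate {A : ℕ} (m : Fin A → ℝ) (V : Config A → ℝ) (E : ℝ)
    (ψ : Config A → ℂ) : Prop :=
  IsSchrodingerViolation m V E ψ (fun _ => 0)

/-- The surface Wronskian term `∮_{|x_a| = R} n · (ξ^* ∇ₐ φ - (∇ₐ ξ^*) φ) dS`, the other particles
being held at `y`.  The sphere of radius `R` is parametrized by `n ↦ R n` on the unit sphere
with its usual surface measure (of total mass `4 π`). -/
def surfaceTerm {A : ℕ} (ξ φ : Config A → ℂ) (a : Fin A) (R : ℝ) (y : Others a) : ℂ :=
  ((R ^ 2 : ℝ) : ℂ) * ∫ n : Metric.sphere (0 : Space) 1,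
    (conj (ξ (place a (R • (n : Space)) y)) *
        partialDeriv a (n : Space) φ (place a (R • (n : Space)) y)
      - conj (partialDeriv a (n : Space) ξ (place a (R • (n : Space)) y)) *
        φ (place a (R • (n : Space)) y)) ∂((volume : Measure Space).toSphere)

end ManyBody

end

/-! Put `f = ξ^*`, again a solution since `V`, `E` and the masses are real; `φ = ψ' - ψ` satisfies
`(E - H) φ = g`. In `f (E - H) φ - φ (E - H) f` the potential cancels and a divergence remains, so
Green's identity on the product of balls `|x_b| < R` equates the weighted sum of fluxes through the
faces `|x_a| = R` with `2M ∫ g ξ^*` over that product. As `g` is integrable and `ξ` bounded, the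
right side converges to `L = 2M ∫ g ξ^*`, which gives existence and the bound together. Under the
domination hypothesis each face integral also converges to the integral of the pointwise limit, and
uniqueness of limits identifies the sum with `L`.

The second derivatives exist only as distributions and the domain has corners, so Green's identity
is proved weakly. Mollification admits `C¹` test functions, which permits testing with `f η` and `φ
η` (`IsSchrodingerViolation.green`). For `η` a product of radial cutoffs, polar coordinates turn the
current into an average of fluxes over a thin shell (`integral_current_radialCutoff`), and letting
the shell collapse gives the sharp identity `IsSchrodingerViolation.sum_flux`. -/

namespace ManyBody

/-! ### Mollification of compactly supported `C¹` functions -/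

section Mollification

open scoped Convolution

variable {G F : Type*} [NormedAddCommGroup G] [NormedSpace ℝ G] [FiniteDimensional ℝ G]
  [MeasurableSpace G] [BorelSpace G] [NormedAddCommGroup F] [NormedSpace ℝ F] [CompleteSpace F]

/-- Convolutions of `h ∈ C_c` with normalized bumps of radius at most `1` are uniformly bounded
and supported in a common compact set. -/
theorem exists_bound_normed_convolution (μ : Measure G) [μ.IsAddHaarMeasure] {h : G → F}
    (hc : Continuous h) (hs : HasCompactSupport h) :
    ∃ (K : Set G) (C : ℝ), IsCompact K ∧ ∀ φ : ContDiffBump (0 : G), φ.rOut ≤ 1 → ∀ x,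
      ‖(φ.normed μ ⋆[ContinuousLinearMap.lsmul ℝ ℝ, μ] h : G → F) x‖
        ≤ K.indicator (fun _ => C) x := by
  obtain ⟨C, hC⟩ := hc.bounded_above_of_compact_support hs
  -- `3 * C`: values of `h` differ by at most `2 * C`, so the average lies within `2 * C` of `h x`,
  -- itself of norm at most `C`.
  refine ⟨Metric.cthickening 1 (tsupport h), 3 * C, hs.isCompact.cthickening, fun φ hφ x => ?_⟩
  by_cases hx : x ∈ Metric.cthickening 1 (tsupport h)
  · rw [Set.indicator_of_mem hx]
    have h1 := φ.dist_normed_convolution_le (μ := μ) (x₀ := x) (ε := 2 * C)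
      hc.aestronglyMeasurable fun y _ => by
        rw [dist_eq_norm]; linarith [norm_sub_le (h y) (h x), hC x, hC y]
    rw [dist_eq_norm] at h1
    linarith [norm_le_norm_add_norm_sub' ((φ.normed μ ⋆[ContinuousLinearMap.lsmul ℝ ℝ, μ] h) x)
      (h x), hC x]
  · rw [Set.indicator_of_notMem hx]
    have h0 : ∀ y ∈ Metric.ball x φ.rOut, h y = 0 := by
      intro y hy
      by_contra hne
      refine hx (Metric.mem_cthickening_of_dist_le x y 1 _ (subset_tsupport _ hne) ?_)
      rw [dist_comm]
      exact (Metric.mem_ball.1 hy).le.trans hφ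
    have hx0 := h0 x (Metric.mem_ball_self φ.rOut_pos)
    have h1 := φ.dist_normed_convolution_le (μ := μ) (x₀ := x) (ε := 0)
      hc.aestronglyMeasurable fun y hy => by rw [h0 y hy, hx0, dist_self]
    rwa [hx0, dist_zero_right] at h1

/-- A compactly supported `C¹` function is a limit of smooth ones, in `C¹` pointwise and
boundedly, with supports in a common compact set. -/
theorem exists_smooth_approximation {η : G → F} (hη : ContDiff ℝ 1 η)
    (hs : HasCompactSupport η) :
    ∃ (θ : ℕ → G → F) (K : Set G) (C : ℝ), IsCompact K ∧ (∀ n, ContDiff ℝ ∞ (θ n)) ∧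
      (∀ n, HasCompactSupport (θ n)) ∧
      (∀ n x, ‖θ n x‖ ≤ K.indicator (fun _ => C) x) ∧
      (∀ n x, ‖fderiv ℝ (θ n) x‖ ≤ K.indicator (fun _ => C) x) ∧
      (∀ x, Tendsto (fun n => θ n x) atTop (𝓝 (η x))) ∧
      ∀ x, Tendsto (fun n => fderiv ℝ (θ n) x) atTop (𝓝 (fderiv ℝ η x)) := by
  let μ : Measure G := Measure.addHaar
  let φ : ℕ → ContDiffBump (0 : G) := fun n =>
    ⟨1 / (2 * ((n : ℝ) + 1)), 1 / ((n : ℝ) + 1), by positivity,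
      one_div_lt_one_div_of_lt (by positivity) (by linarith [(n.cast_nonneg : (0 : ℝ) ≤ n)])⟩
  have hφ1 : ∀ n, (φ n).rOut ≤ 1 := fun n => by
    change 1 / ((n : ℝ) + 1) ≤ 1
    rw [div_le_one (by positivity)]
    linarith [(n.cast_nonneg : (0 : ℝ) ≤ n)]
  have hφ0 : Tendsto (fun n => (φ n).rOut) atTop (𝓝 0) := tendsto_one_div_add_atTop_nhds_zero_nat
  let L := ContinuousLinearMap.lsmul ℝ ℝ (E := F)
  have hdc : Continuous (fderiv ℝ η) := hη.continuous_fderiv one_ne_zero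
  -- The derivative falls on `η`, so the sup bound and the convergence for continuous functions
  -- apply to `fderiv ℝ η` as well.
  have hder : ∀ n x, fderiv ℝ ((φ n).normed μ ⋆[L, μ] η) x
      = ((φ n).normed μ ⋆[ContinuousLinearMap.lsmul ℝ ℝ, μ] fderiv ℝ η) x := by
    intro n x
    rw [(hs.hasFDerivAt_convolution_right L
      ((φ n).continuous_normed.locallyIntegrable) hη x).fderiv]
    rfl
  obtain ⟨K₁, C₁, hK₁, hb₁⟩ := exists_bound_normed_convolution μ hη.continuous hs
  obtain ⟨K₂, C₂, hK₂, hb₂⟩ := exists_bound_normed_convolution μ hdc (hs.fderiv ℝ)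
  have hmono : ∀ x, K₁.indicator (fun _ => C₁) x ≤ (K₁ ∪ K₂).indicator (fun _ => max |C₁| |C₂|) x ∧
      K₂.indicator (fun _ => C₂) x ≤ (K₁ ∪ K₂).indicator (fun _ => max |C₁| |C₂|) x := by
    intro x
    have h1 := le_abs_self C₁
    have h2 := le_abs_self C₂
    by_cases hx1 : x ∈ K₁ <;> by_cases hx2 : x ∈ K₂ <;> simp [hx1, hx2, h1, h2]
  refine ⟨fun n => (φ n).normed μ ⋆[L, μ] η, K₁ ∪ K₂, max |C₁| |C₂|, hK₁.union hK₂,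
    fun n => (φ n).hasCompactSupport_normed.contDiff_convolution_left L (φ n).contDiff_normed
      hη.continuous.locallyIntegrable,
    fun n => (φ n).hasCompactSupport_normed.convolution L hs,
    fun n x => (hb₁ _ (hφ1 n) x).trans (hmono x).1,
    fun n x => ?_,
    fun x => ContDiffBump.convolution_tendsto_right_of_continuous hφ0 hη.continuous x,
    fun x => ?_⟩
  · rw [hder]
    exact (hb₂ _ (hφ1 n) x).trans (hmono x).2
  · simp_rw [hder]
    exact ContDiffBump.convolution_tendsto_right_of_continuous hφ0 hdc x

end Mollification

/-- Dominated convergence for the pairing of a locally integrable function with functions that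
are bounded and supported in a common compact set. -/
theorem tendsto_integral_mul_of_locallyIntegrable {G : Type*} [TopologicalSpace G] [T2Space G]
    [MeasurableSpace G] [BorelSpace G] {μ : Measure G} {u : G → ℂ} (hu : LocallyIntegrable u μ)
    {ι : Type*} {l : Filter ι} [l.IsCountablyGenerated] {θ : ι → G → ℂ} {η : G → ℂ} {K : Set G} {C : ℝ}
    (hK : IsCompact K) (hθ : ∀ᶠ n in l, AEStronglyMeasurable (θ n) μ)
    (hum : AEStronglyMeasurable u μ)
    (hb : ∀ᶠ n in l, ∀ x, ‖θ n x‖ ≤ K.indicator (fun _ => C) x)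
    (hlim : ∀ x, Tendsto (fun n => θ n x) l (𝓝 (η x))) :
    Tendsto (fun n => ∫ x, u x * θ n x ∂μ) l (𝓝 (∫ x, u x * η x ∂μ)) := by
  refine tendsto_integral_filter_of_dominated_convergence
    (K.indicator fun x => ‖u x‖ * C) (hθ.mono fun n hn => hum.mul hn) ?_ ?_ ?_
  · filter_upwards [hb] with n hn
    refine ae_of_all _ fun x => ?_
    rw [norm_mul]
    refine (mul_le_mul_of_nonneg_left (hn x) (norm_nonneg _)).trans (le_of_eq ?_)
    by_cases hx : x ∈ K <;> simp [hx]
  · rw [integrable_indicator_iff hK.measurableSet]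
    exact ((hu.integrableOn_isCompact hK).norm).mul_const C
  · exact ae_of_all _ fun x => (hlim x).const_mul _

/-- A locally integrable function times a compactly supported continuous one is integrable. -/
theorem integrable_mul_of_hasCompactSupport {A : ℕ} {u η : Config A → ℂ}
    (hu : LocallyIntegrable u volume) (hη : Continuous η) (hs : HasCompactSupport η) :
    Integrable (fun x => u x * η x) volume :=
  hu.integrable_smul_right_of_hasCompactSupport hη hs

/-! ### The weak equation and Green's identity -/

variable {A : ℕ} {m : Fin A → ℝ} {V : Config A → ℝ} {E : ℝ}

theorem continuous_partialDeriv {f : Config A → ℂ} (hf : ContDiff ℝ 1 f) (a : Fin A) (v : Space) :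
    Continuous (partialDeriv a v f) :=
  (hf.continuous_fderiv one_ne_zero).clm_apply continuous_const

theorem hasCompactSupport_partialDeriv {f : Config A → ℂ} (hf : HasCompactSupport f) (a : Fin A)
    (v : Space) : HasCompactSupport (partialDeriv a v f) :=
  hf.fderiv_apply ℝ _

theorem partialDeriv_mul {f h : Config A → ℂ} (hf : ContDiff ℝ 1 f) (hh : ContDiff ℝ 1 h)
    (a : Fin A) (v : Space) (x : Config A) :
    partialDeriv a v (fun x => f x * h x) x
      = f x * partialDeriv a v h x + h x * partialDeriv a v f x := by
  unfold partialDeriv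
  rw [fderiv_fun_mul (hf.differentiable one_ne_zero x) (hh.differentiable one_ne_zero x)]
  simp

theorem gradDot_comm (a : Fin A) (f h : Config A → ℂ) (x : Config A) :
    gradDot a f h x = gradDot a h f x := by
  simp only [gradDot, mul_comm]

theorem gradDot_mul_right {f h : Config A → ℂ} (hf : ContDiff ℝ 1 f) (hh : ContDiff ℝ 1 h)
    (a : Fin A) (u : Config A → ℂ) (x : Config A) :
    gradDot a u (fun x => f x * h x) x = f x * gradDot a u h x + h x * gradDot a u f x := by
  simp only [gradDot, partialDeriv_mul hf hh, Finset.mul_sum, ← Finset.sum_add_distrib]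
  exact Finset.sum_congr rfl fun j _ => by ring

theorem continuous_gradDot {f h : Config A → ℂ} (hf : ContDiff ℝ 1 f) (hh : ContDiff ℝ 1 h)
    (a : Fin A) : Continuous (gradDot a f h) :=
  continuous_finsetSum _ fun _ _ =>
    (continuous_partialDeriv hf _ _).mul (continuous_partialDeriv hh _ _)

theorem hasCompactSupport_gradDot {h : Config A → ℂ} (hh : HasCompactSupport h) (a : Fin A)
    (f : Config A → ℂ) : HasCompactSupport (gradDot a f h) := by
  have h0 : ∀ x, x ∉ tsupport h → gradDot a f h x = 0 := fun x hx =>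
    Finset.sum_eq_zero fun j _ => by
      rw [partialDeriv, partialDeriv, image_eq_zero_of_notMem_tsupport
        (fun hx' => hx (tsupport_fderiv_subset ℝ hx')), zero_apply, mul_zero]
  exact HasCompactSupport.intro hh h0

theorem locallyIntegrable_potential_mul (hV : LocallyIntegrable V volume) {f : Config A → ℂ}
    (hf : Continuous f) :
    LocallyIntegrable (fun x => ((E - V x : ℝ) : ℂ) * f x) volume := by
  have h1 : LocallyIntegrable (fun x => E - V x) volume :=
    continuous_const.locallyIntegrable.sub hV
  have h2 : LocallyIntegrable (fun x => (((E - V x : ℝ)) : ℂ)) volume :=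
    h1.mono (Complex.continuous_ofReal.comp_aestronglyMeasurable h1.aestronglyMeasurable)
      (ae_of_all _ fun x => by rw [Complex.norm_real])
  exact h2.smul_continuous hf

theorem integrable_potential_term (hV : LocallyIntegrable V volume) {f η : Config A → ℂ}
    (hf : Continuous f) (hη : Continuous η) (hs : HasCompactSupport η) :
    Integrable (fun x => ((E - V x : ℝ) : ℂ) * f x * η x) volume :=
  integrable_mul_of_hasCompactSupport (locallyIntegrable_potential_mul hV hf) hη hs

theorem integrable_gradDot {f η : Config A → ℂ} (hf : ContDiff ℝ 1 f) (hη : ContDiff ℝ 1 η)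
    (hs : HasCompactSupport η) (a : Fin A) : Integrable (gradDot a f η) volume :=
  (continuous_gradDot hf hη a).integrable_of_hasCompactSupport (hasCompactSupport_gradDot hs a f)

theorem integral_weak_form (hV : LocallyIntegrable V volume) {f η : Config A → ℂ}
    (hf : ContDiff ℝ 1 f) (hη : ContDiff ℝ 1 η) (hs : HasCompactSupport η) :
    ∫ x, (((E - V x : ℝ) : ℂ) * f x * η x
        - ∑ a : Fin A, ((1 / (2 * m a) : ℝ) : ℂ) * gradDot a f η x)
      = (∫ x, ((E - V x : ℝ) : ℂ) * f x * η x)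
        - ∑ a : Fin A, ((1 / (2 * m a) : ℝ) : ℂ) * ∫ x, gradDot a f η x := by
  rw [integral_sub (integrable_potential_term hV hf.continuous hη.continuous hs)
    (integrable_finsetSum _ fun a _ => (integrable_gradDot hf hη hs a).const_mul _),
    integral_finsetSum _ fun a _ => (integrable_gradDot hf hη hs a).const_mul _]
  simp only [integral_const_mul]

/-- The distributional equation `(E - H) f = g` may be tested against `C¹` functions. -/
theorem IsSchrodingerViolation.weak_form (hV : LocallyIntegrable V volume) {f g η : Config A → ℂ}
    (h : IsSchrodingerViolation m V E f g) (hη : ContDiff ℝ 1 η) (hs : HasCompactSupport η) :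
    (∫ x, ((E - V x : ℝ) : ℂ) * f x * η x)
        - ∑ a : Fin A, ((1 / (2 * m a) : ℝ) : ℂ) * ∫ x, gradDot a f η x
      = ∫ x, g x * η x := by
  obtain ⟨hf, hg, htest⟩ := h
  obtain ⟨θ, K, C, hK, hθ, hθs, hb, hb', hlim, hlim'⟩ := exists_smooth_approximation hη hs
  have hθ1 : ∀ n, ContDiff ℝ 1 (θ n) := fun n => (hθ n).of_le (by exact_mod_cast le_top)
  have key : ∀ {u : Config A → ℂ}, LocallyIntegrable u volume →
      Tendsto (fun n => ∫ x, u x * θ n x) atTop (𝓝 (∫ x, u x * η x)) := fun hu =>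
    tendsto_integral_mul_of_locallyIntegrable hu hK
      (.of_forall fun n => (hθ n).continuous.aestronglyMeasurable) hu.aestronglyMeasurable
      (.of_forall hb) hlim
  have key' : ∀ a, Tendsto (fun n => ∫ x, gradDot a f (θ n) x) atTop
      (𝓝 (∫ x, gradDot a f η x)) := by
    intro a
    have hint : ∀ {h : Config A → ℂ}, ContDiff ℝ 1 h → HasCompactSupport h → ∀ j : Fin 3,
        Integrable (fun x => partialDeriv a (EuclideanSpace.single j 1) f x *
          partialDeriv a (EuclideanSpace.single j 1) h x) volume := fun hh hhs j =>
      integrable_mul_of_hasCompactSupport (continuous_partialDeriv hf _ _).locallyIntegrable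
        (continuous_partialDeriv hh _ _) (hasCompactSupport_partialDeriv hhs _ _)
    simp only [gradDot]
    rw [integral_finsetSum _ fun j _ => hint hη hs j]
    simp_rw [integral_finsetSum _ fun j _ => hint (hθ1 _) (hθs _) j]
    refine tendsto_finsetSum _ fun j _ => ?_
    refine tendsto_integral_mul_of_locallyIntegrable
      (C := C * ‖(Pi.single a (EuclideanSpace.single j 1) : Config A)‖)
      (continuous_partialDeriv hf _ _).locallyIntegrable hK
      (.of_forall fun n => (continuous_partialDeriv (hθ1 n) _ _).aestronglyMeasurable)
      (continuous_partialDeriv hf _ _).aestronglyMeasurable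
      (.of_forall fun n x => ?_) fun x =>
        ((ContinuousLinearMap.apply ℝ ℂ _).continuous.tendsto _).comp (hlim' x)
    refine ((fderiv ℝ (θ n) x).le_opNorm _).trans
      ((mul_le_mul_of_nonneg_right (hb' n x) (norm_nonneg _)).trans (le_of_eq ?_))
    by_cases hx : x ∈ K <;> simp [hx]
  refine tendsto_nhds_unique (((key (locallyIntegrable_potential_mul (E := E) hV
    hf.continuous)).sub (tendsto_finsetSum Finset.univ fun a _ => (key' a).const_mul _)).congr
      fun n => ?_) (key hg)
  rw [← htest (θ n) (hθ n) (hθs n), integral_weak_form hV hf (hθ1 n) (hθs n)]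

/-- Green's identity: the weak divergence of the Wronskian current of two `C¹` functions. -/
theorem IsSchrodingerViolation.green (hV : LocallyIntegrable V volume)
    {f φ gf gφ η : Config A → ℂ} (hf : IsSchrodingerViolation m V E f gf)
    (hφ : IsSchrodingerViolation m V E φ gφ) (hη : ContDiff ℝ 1 η) (hs : HasCompactSupport η) :
    ∑ a : Fin A, ((1 / (2 * m a) : ℝ) : ℂ) *
        ∫ x, (φ x * gradDot a f η x - f x * gradDot a φ η x)
      = ∫ x, (gφ x * f x - gf x * φ x) * η x := by
  -- The test functions `f η` and `φ η` are only `C¹`, hence the extended weak form.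
  have h1 := hφ.weak_form hV (hf.1.mul hη) hs.mul_left
  have h2 := hf.weak_form hV (hφ.1.mul hη) hs.mul_left
  have i1 : Integrable (fun x => gφ x * (f x * η x)) volume :=
    integrable_mul_of_hasCompactSupport hφ.2.1 (hf.1.mul hη).continuous hs.mul_left
  have i2 : Integrable (fun x => gf x * (φ x * η x)) volume :=
    integrable_mul_of_hasCompactSupport hf.2.1 (hφ.1.mul hη).continuous hs.mul_left
  have e3 : ∫ x, (gφ x * f x - gf x * φ x) * η x
      = (∫ x, gφ x * (f x * η x)) - ∫ x, gf x * (φ x * η x) := by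
    rw [← integral_sub i1 i2]
    exact integral_congr_ae (ae_of_all _ fun x => by ring)
  have e4 : ∫ x, ((E - V x : ℝ) : ℂ) * φ x * (f x * η x)
      = ∫ x, ((E - V x : ℝ) : ℂ) * f x * (φ x * η x) :=
    integral_congr_ae (ae_of_all _ fun x => by ring)
  -- By Leibniz both gradients contain `η ∇ₐf · ∇ₐφ`; the symmetry of `gradDot` cancels it.
  have e5 : ∀ a, ∫ x, (φ x * gradDot a f η x - f x * gradDot a φ η x)
      = (∫ x, gradDot a f (fun x => φ x * η x) x) - ∫ x, gradDot a φ (fun x => f x * η x) x := by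
    intro a
    rw [← integral_sub (integrable_gradDot hf.1 (hφ.1.mul hη) hs.mul_left a)
      (integrable_gradDot hφ.1 (hf.1.mul hη) hs.mul_left a)]
    refine integral_congr_ae (ae_of_all _ fun x => ?_)
    simp only [gradDot_mul_right hφ.1 hη, gradDot_mul_right hf.1 hη, gradDot_comm a φ f]
    ring
  rw [e3, ← h1, ← h2, e4]
  simp only [e5, mul_sub, Finset.sum_sub_distrib]
  ring

theorem partialDeriv_conj {f : Config A → ℂ} (hf : ContDiff ℝ 1 f) (a : Fin A) (v : Space)
    (x : Config A) : partialDeriv a v (fun x => conj (f x)) x = conj (partialDeriv a v f x) := by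
  unfold partialDeriv
  exact congrArg (fun L => L (Pi.single a v))
    (Complex.conjCLE.toContinuousLinearMap.hasFDerivAt.comp x
      (hf.differentiable one_ne_zero x).hasFDerivAt).fderiv

/-- All coefficients are real, so conjugating the equation tested with `conj η` gives the one tested
with `η`. -/
theorem IsSchrodingerViolation.conj {f g : Config A → ℂ} (h : IsSchrodingerViolation m V E f g) :
    IsSchrodingerViolation m V E (fun x => conj (f x)) (fun x => conj (g x)) := by
  obtain ⟨hf, hg, htest⟩ := h
  refine ⟨Complex.conjCLE.contDiff.comp hf,
    hg.mono (Complex.continuous_conj.comp_aestronglyMeasurable hg.aestronglyMeasurable)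
      (ae_of_all _ fun x => by simp), fun η hη hs => ?_⟩
  have h1 := congrArg conj (htest (fun x => conj (η x)) (Complex.conjCLE.contDiff.comp hη)
    (hs.comp_left (map_zero _)))
  rw [← integral_conj, ← integral_conj] at h1
  refine (integral_congr_ae (ae_of_all _ fun x => ?_)).trans
    (h1.trans (integral_congr_ae (ae_of_all _ fun x => ?_)))
  · have hη1 : ContDiff ℝ 1 η := hη.of_le (by exact_mod_cast le_top)
    simp only [map_sub, map_mul, map_sum, gradDot, partialDeriv_conj hf, partialDeriv_conj hη1,
      Complex.conj_ofReal, Complex.conj_conj]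
  · simp

theorem IsSchrodingerViolation.sub (hV : LocallyIntegrable V volume) {f₁ f₂ g₁ g₂ : Config A → ℂ}
    (h₁ : IsSchrodingerViolation m V E f₁ g₁) (h₂ : IsSchrodingerViolation m V E f₂ g₂) :
    IsSchrodingerViolation m V E (fun x => f₁ x - f₂ x) (fun x => g₁ x - g₂ x) := by
  refine ⟨h₁.1.sub h₂.1, h₁.2.1.sub h₂.2.1, fun η hη hs => ?_⟩
  have hη1 : ContDiff ℝ 1 η := hη.of_le (by exact_mod_cast le_top)
  have hpd : ∀ a v x, partialDeriv a v (fun x => f₁ x - f₂ x) x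
      = partialDeriv a v f₁ x - partialDeriv a v f₂ x := by
    intro a v x
    unfold partialDeriv
    rw [fderiv_fun_sub (h₁.1.differentiable one_ne_zero x) (h₂.1.differentiable one_ne_zero x)]
    rfl
  have hI : ∀ {f : Config A → ℂ}, ContDiff ℝ 1 f → Integrable (fun x =>
      ((E - V x : ℝ) : ℂ) * f x * η x
        - ∑ a : Fin A, ((1 / (2 * m a) : ℝ) : ℂ) * gradDot a f η x) volume := fun hf =>
    (integrable_potential_term hV hf.continuous hη.continuous hs).sub
      (integrable_finsetSum _ fun a _ => (integrable_gradDot hf hη1 hs a).const_mul _)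
  have e1 := integral_sub (hI h₁.1) (hI h₂.1)
  have e2 := integral_sub (integrable_mul_of_hasCompactSupport h₁.2.1 hη.continuous hs)
    (integrable_mul_of_hasCompactSupport h₂.2.1 hη.continuous hs)
  rw [h₁.2.2 η hη hs, h₂.2.2 η hη hs, ← e2] at e1
  refine (integral_congr_ae (ae_of_all _ fun x => ?_)).trans
    (e1.trans (integral_congr_ae (ae_of_all _ fun x => ?_)))
  · simp only [gradDot, hpd, sub_mul, Finset.sum_sub_distrib, mul_sub]
    ring
  · simp only [sub_mul]

/-! ### Polar coordinates and separation of one particle -/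

/-- Integration in polar coordinates of `ℝ³`. -/
theorem integral_space_polar {f : Space → ℂ} (hf : Integrable f volume) :
    ∫ p, f p = ∫ r in Set.Ioi (0 : ℝ), ((r ^ 2 : ℝ) : ℂ) *
      ∫ n : Metric.sphere (0 : Space) 1, f (r • (n : Space)) ∂((volume : Measure Space).toSphere) := by
  -- Away from the null set `{0}`, Lebesgue measure is the product of surface measure and `r ^ 2
  -- dr`.
  have hmp := (volume : Measure Space).measurePreserving_homeomorphUnitSphereProd
  have hme := (homeomorphUnitSphereProd Space).measurableEmbedding
  have hd : Module.finrank ℝ Space - 1 = 2 := by simp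
  rw [hd] at hmp
  let F : Metric.sphere (0 : Space) 1 × Set.Ioi (0 : ℝ) → ℂ := fun q => f ((q.2 : ℝ) • (q.1 : Space))
  have hF : ∀ x : ({0}ᶜ : Set Space), F (homeomorphUnitSphereProd Space x) = f (x : Space) := by
    intro x
    have := congrArg Subtype.val ((homeomorphUnitSphereProd Space).symm_apply_apply x)
    rw [homeomorphUnitSphereProd_symm_apply_coe] at this
    exact congrArg f this
  have hFint : Integrable F
      ((volume : Measure Space).toSphere.prod (Measure.volumeIoiPow 2)) := by
    rw [← hmp.integrable_comp_emb hme]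
    have h1 : IntegrableOn f ({0}ᶜ : Set Space) volume := hf.integrableOn
    rw [integrableOn_iff_comap_subtypeVal (measurableSet_singleton _).compl] at h1
    exact h1.congr (ae_of_all _ fun x => (hF x).symm)
  calc ∫ p, f p = ∫ x : ({0}ᶜ : Set Space), f (x : Space) ∂(volume.comap Subtype.val) := by
        rw [integral_subtype_comap (measurableSet_singleton _).compl fun x => f x,
          restrict_compl_singleton]
    _ = ∫ q, F q ∂((volume : Measure Space).toSphere.prod (Measure.volumeIoiPow 2)) := by
        rw [← hmp.integral_comp hme]
        exact integral_congr_ae (ae_of_all _ fun x => (hF x).symm)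
    _ = ∫ r : Set.Ioi (0 : ℝ), ∫ n : Metric.sphere (0 : Space) 1, f ((r : ℝ) • (n : Space))
          ∂((volume : Measure Space).toSphere) ∂(Measure.volumeIoiPow 2) :=
        integral_prod_symm _ hFint
    _ = _ := by
        simp only [Measure.volumeIoiPow, ENNReal.ofReal]
        rw [integral_withDensity_eq_integral_smul (by fun_prop),
          integral_subtype_comap measurableSet_Ioi fun r : ℝ => Real.toNNReal (r ^ 2) •
            ∫ n : Metric.sphere (0 : Space) 1, f (r • (n : Space))
              ∂((volume : Measure Space).toSphere)]
        refine setIntegral_congr_fun measurableSet_Ioi fun r hr => ?_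
        simp only [NNReal.smul_def, Real.coe_toNNReal _ (sq_nonneg r), Complex.real_smul]

theorem place_eq_add_single (a : Fin A) (p : Space) (y : Others a) :
    place a p y = place a 0 y + Pi.single a p := by
  funext b
  by_cases h : b = a
  · subst h; simp [place]
  · simp [place, h]

theorem place_apply_self (a : Fin A) (p : Space) (y : Others a) : place a p y a = p := by
  simp [place]

theorem place_apply_ne (a : Fin A) (p : Space) (y : Others a) (b : {b : Fin A // b ≠ a}) :
    place a p y b = y b := by
  simp [place, b.2]

theorem continuous_place (a : Fin A) : Continuous fun q : Space × Others a => place a q.1 q.2 := by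
  refine continuous_pi fun b => ?_
  by_cases h : b = a
  · simp only [place, h, dite_true]; fun_prop
  · simp only [place, h, dite_false]; fun_prop

theorem hasFDerivAt_place (a : Fin A) (p : Space) (y : Others a) :
    HasFDerivAt (fun p => place a p y)
      (ContinuousLinearMap.single ℝ (fun _ : Fin A => Space) a) p := by
  have h := ((ContinuousLinearMap.single ℝ (fun _ : Fin A => Space) a).hasFDerivAt
    (x := p)).const_add (place a 0 y)
  refine h.congr_of_eventuallyEq (.of_forall fun q => ?_)
  exact place_eq_add_single a q y

theorem measurePreserving_place (a : Fin A) :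
    MeasurePreserving (fun q : Space × Others a => place a q.1 q.2) volume volume := by
  have h1 : MeasurePreserving (MeasurableEquiv.piEquivPiSubtypeProd (fun _ : Fin A => Space)
      (fun b => b = a)).symm (volume : Measure (({b : Fin A // b = a} → Space) × Others a))
      volume := by
    convert (volume_preserving_piEquivPiSubtypeProd (fun _ : Fin A => Space)
      (fun b => b = a)).symm <;> rfl
  have h2 := (volume_preserving_funUnique {b : Fin A // b = a} Space).symm
  have h3 : MeasurePreserving (Prod.map (MeasurableEquiv.funUnique {b : Fin A // b = a} Space).symm
      (id : Others a → Others a)) volume volume := h2.prod (MeasurePreserving.id volume)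
  exact MeasurePreserving.comp (g := (MeasurableEquiv.piEquivPiSubtypeProd
    (fun _ : Fin A => Space) (fun b => b = a)).symm) h1 h3

theorem integral_place (a : Fin A) {F : Config A → ℂ} (hF : Integrable F volume) :
    ∫ x, F x = ∫ y : Others a, ∫ p, F (place a p y) := by
  have hmp := measurePreserving_place a
  have h1 : ∫ x, F x = ∫ q : Space × Others a, F (place a q.1 q.2) := by
    have := hF.aestronglyMeasurable
    rw [← hmp.map_eq] at this
    rw [← hmp.map_eq, integral_map hmp.measurable.aemeasurable this]
  rw [h1]
  exact integral_prod_symm _ (hmp.integrable_comp_of_integrable hF)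

/-! ### Radial cutoffs and fluxes -/

/-- The product `∏_b κ(|x_b|)` of radial profiles. -/
noncomputable def radialCutoff {ι : Type*} [Fintype ι] (κ : ℝ → ℝ) (x : ι → Space) : ℂ :=
  ((∏ b, κ ‖x b‖ : ℝ) : ℂ)

/-- The bilinear Wronskian density `f ∂ₙφ - (∂ₙf) φ` of particle `a` in direction `n`. -/
noncomputable def wronskian (f φ : Config A → ℂ) (a : Fin A) (n : Space) (x : Config A) : ℂ :=
  f x * partialDeriv a n φ x - partialDeriv a n f x * φ x

/-- The flux of the Wronskian current of particle `a` through the sphere of radius `r`. -/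
noncomputable def flux (f φ : Config A → ℂ) (a : Fin A) (r : ℝ) (y : Others a) : ℂ :=
  ((r ^ 2 : ℝ) : ℂ) * ∫ n : Metric.sphere (0 : Space) 1,
    wronskian f φ a (n : Space) (place a (r • (n : Space)) y) ∂((volume : Measure Space).toSphere)

theorem surfaceTerm_eq_flux {ξ : Config A → ℂ} (hξ : ContDiff ℝ 1 ξ) (φ : Config A → ℂ)
    (a : Fin A) (r : ℝ) (y : Others a) :
    surfaceTerm ξ φ a r y = flux (fun x => conj (ξ x)) φ a r y := by
  simp only [surfaceTerm, flux, wronskian, partialDeriv_conj hξ]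

/-- The norm is smooth away from the origin, and near the origin `κ ‖p‖` is constant. -/
theorem contDiff_radial {κ : ℝ → ℝ} (hκ : ContDiff ℝ 1 κ) {δ : ℝ} (hδ : 0 < δ)
    (h1 : ∀ r < δ, κ r = 1) : ContDiff ℝ 1 fun p : Space => κ ‖p‖ := by
  rw [contDiff_iff_contDiffAt]
  intro p
  by_cases hp : p = 0
  · have : (fun p : Space => κ ‖p‖) =ᶠ[𝓝 p] fun _ => 1 := by
      have hlt : ∀ᶠ q : Space in 𝓝 p, ‖q‖ < δ :=
        continuous_norm.continuousAt.eventually_lt_const (by simpa [hp] using hδ)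
      filter_upwards [hlt] with q hq using h1 _ hq
    exact contDiffAt_const.congr_of_eventuallyEq this
  · exact hκ.contDiffAt.comp p (contDiffAt_norm ℝ hp)

theorem fderiv_radial {κ : ℝ → ℝ} (hκ : ContDiff ℝ 1 κ) {r : ℝ} (hr : 0 < r)
    (n : Metric.sphere (0 : Space) 1) (v : Space) :
    fderiv ℝ (fun p : Space => κ ‖p‖) (r • (n : Space)) v = deriv κ r * inner ℝ (n : Space) v := by
  have hn : ‖(n : Space)‖ = 1 := by simp
  have hrn : ‖r • (n : Space)‖ = r := by rw [norm_smul, hn, mul_one, Real.norm_of_nonneg hr.le]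
  have h1 := ((hasFDerivAt_id (𝕜 := ℝ) (r • (n : Space))).norm_sq).sqrt
    (by simp only [id, hrn]; positivity)
  have h2 : HasFDerivAt (fun p : Space => ‖p‖) _ (r • (n : Space)) :=
    h1.congr_of_eventuallyEq (.of_forall fun p => by simp [Real.sqrt_sq (norm_nonneg p)])
  have h3 : HasDerivAt κ (deriv κ r) ‖r • (n : Space)‖ := by
    rw [hrn]; exact (hκ.differentiable one_ne_zero r).hasDerivAt
  have h4 := (h3.comp_hasFDerivAt _ h2).fderiv
  have h5 : fderiv ℝ (fun p : Space => κ ‖p‖) (r • (n : Space)) = _ := h4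
  rw [h5]
  simp only [id, hrn, Real.sqrt_sq hr.le, smul_apply, ContinuousLinearMap.comp_apply,
    innerSL_apply_apply, ContinuousLinearMap.id_apply, real_inner_smul_left, smul_eq_mul,
    nsmul_eq_mul]
  push_cast
  field_simp

section Cutoff

variable {ι : Type*} [Fintype ι] {κ : ℝ → ℝ} {R : ℝ}

theorem contDiff_radialCutoff (hκ : ContDiff ℝ 1 κ) {δ : ℝ} (hδ : 0 < δ)
    (h1 : ∀ r < δ, κ r = 1) : ContDiff ℝ 1 (radialCutoff κ : (ι → Space) → ℂ) :=
  Complex.ofRealCLM.contDiff.comp (contDiff_prod fun b _ =>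
    (contDiff_radial hκ hδ h1).comp (contDiff_apply ℝ Space b))

theorem radialCutoff_eq_zero (h0 : ∀ r, R ≤ r → κ r = 0) {x : ι → Space} {b : ι}
    (hb : R ≤ ‖x b‖) : radialCutoff κ x = 0 := by
  rw [radialCutoff, Finset.prod_eq_zero (Finset.mem_univ b) (h0 _ hb), Complex.ofReal_zero]

theorem hasCompactSupport_radialCutoff (hR : 0 ≤ R) (h0 : ∀ r, R ≤ r → κ r = 0) :
    HasCompactSupport (radialCutoff κ : (ι → Space) → ℂ) := by
  refine HasCompactSupport.intro (isCompact_closedBall (0 : ι → Space) R) fun x hx => ?_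
  rw [mem_closedBall_zero_iff, pi_norm_le_iff_of_nonneg hR] at hx
  push Not at hx
  obtain ⟨b, hb⟩ := hx
  exact radialCutoff_eq_zero h0 hb.le

end Cutoff

theorem radialCutoff_place (κ : ℝ → ℝ) (a : Fin A) (p : Space) (y : Others a) :
    radialCutoff κ (place a p y) = radialCutoff κ y * ((κ ‖p‖ : ℝ) : ℂ) := by
  rw [radialCutoff, radialCutoff, Fintype.prod_eq_mul_prod_subtype_ne _ a, place_apply_self]
  simp only [place_apply_ne, Complex.ofReal_mul, mul_comm]

theorem partialDeriv_place {η : Config A → ℂ} (hη : ContDiff ℝ 1 η) (a : Fin A) (v p : Space)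
    (y : Others a) :
    partialDeriv a v η (place a p y) = fderiv ℝ (fun q => η (place a q y)) p v := by
  have h := ((hη.differentiable one_ne_zero (place a p y)).hasFDerivAt.comp p
    (hasFDerivAt_place a p y)).fderiv
  exact (congrArg (fun L => L v) h).symm

theorem partialDeriv_radialCutoff {κ : ℝ → ℝ} (hκ : ContDiff ℝ 1 κ) {δ : ℝ} (hδ : 0 < δ)
    (h1 : ∀ r < δ, κ r = 1) (a : Fin A) (v : Space) {r : ℝ} (hr : 0 < r)
    (n : Metric.sphere (0 : Space) 1) (y : Others a) :
    partialDeriv a v (radialCutoff κ) (place a (r • (n : Space)) y)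
      = radialCutoff κ y * ((deriv κ r * inner ℝ (n : Space) v : ℝ) : ℂ) := by
  rw [partialDeriv_place (contDiff_radialCutoff hκ hδ h1)]
  simp only [radialCutoff_place]
  have hd : HasFDerivAt (fun p : Space => κ ‖p‖) _ (r • (n : Space)) :=
    ((contDiff_radial hκ hδ h1).differentiable one_ne_zero _).hasFDerivAt
  have h2 := ((Complex.ofRealCLM.hasFDerivAt.comp _ hd).const_mul (radialCutoff κ y)).fderiv
  refine (congrArg (fun L => L v) h2).trans ?_
  simp [fderiv_radial hκ hr n v]

theorem sum_inner_mul_partialDeriv (f : Config A → ℂ) (a : Fin A) (n : Space) (x : Config A) :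
    ∑ j : Fin 3, partialDeriv a (EuclideanSpace.single j 1) f x *
      ((inner ℝ n (EuclideanSpace.single j (1 : ℝ)) : ℝ) : ℂ) = partialDeriv a n f x := by
  have hn : n = ∑ j : Fin 3, (inner ℝ n (EuclideanSpace.single j (1 : ℝ)) : ℝ) •
      (EuclideanSpace.single j (1 : ℝ) : Space) := by
    have := (EuclideanSpace.basisFun (Fin 3) ℝ).sum_repr' n
    refine this.symm.trans (Finset.sum_congr rfl fun j _ => ?_)
    rw [EuclideanSpace.basisFun_apply, real_inner_comm]
  have h2 : ∀ v, partialDeriv a v f x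
      = ((fderiv ℝ f x).comp (ContinuousLinearMap.single ℝ (fun _ : Fin A => Space) a)) v :=
    fun v => rfl
  conv_rhs => rw [hn, h2, map_sum]
  refine Finset.sum_congr rfl fun j _ => ?_
  rw [map_smul, h2, Complex.real_smul, mul_comm]

/-- The `a`-gradient of the cutoff is radial, so only the normal derivative of `f` survives; this is
how the Wronskian flux arises. -/
theorem gradDot_radialCutoff {κ : ℝ → ℝ} (hκ : ContDiff ℝ 1 κ) {δ : ℝ} (hδ : 0 < δ)
    (h1 : ∀ r < δ, κ r = 1) (f : Config A → ℂ) (a : Fin A) {r : ℝ} (hr : 0 < r)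
    (n : Metric.sphere (0 : Space) 1) (y : Others a) :
    gradDot a f (radialCutoff κ) (place a (r • (n : Space)) y)
      = radialCutoff κ y * ((deriv κ r : ℝ) : ℂ) *
        partialDeriv a (n : Space) f (place a (r • (n : Space)) y) := by
  rw [← sum_inner_mul_partialDeriv f a n, Finset.mul_sum]
  refine Finset.sum_congr rfl fun j _ => ?_
  rw [partialDeriv_radialCutoff hκ hδ h1 a _ hr n y, Complex.ofReal_mul]
  ring

/-- Tested against a product of radial profiles, the Wronskian current is an average of fluxes
through spheres. -/
theorem integral_current_radialCutoff {κ : ℝ → ℝ} (hκ : ContDiff ℝ 1 κ) {δ R : ℝ} (hδ : 0 < δ)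
    (h1 : ∀ r < δ, κ r = 1) (hR : 0 ≤ R) (h0 : ∀ r, R ≤ r → κ r = 0) {f φ : Config A → ℂ}
    (hf : ContDiff ℝ 1 f) (hφ : ContDiff ℝ 1 φ) (a : Fin A) :
    ∫ x, (φ x * gradDot a f (radialCutoff κ) x - f x * gradDot a φ (radialCutoff κ) x)
      = ∫ y : Others a, radialCutoff κ y *
          ∫ r, (((-deriv κ r : ℝ)) : ℂ) * flux f φ a r y := by
  have hη : ContDiff ℝ 1 (radialCutoff κ : Config A → ℂ) := contDiff_radialCutoff hκ hδ h1
  have hs : HasCompactSupport (radialCutoff κ : Config A → ℂ) :=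
    hasCompactSupport_radialCutoff hR h0
  set F : Config A → ℂ := fun x =>
    φ x * gradDot a f (radialCutoff κ) x - f x * gradDot a φ (radialCutoff κ) x with hF
  have hFc : Continuous F := (hφ.continuous.mul (continuous_gradDot hf hη a)).sub
    (hf.continuous.mul (continuous_gradDot hφ hη a))
  have hFs : HasCompactSupport F := (hasCompactSupport_gradDot hs a f).mul_left.sub
    (hasCompactSupport_gradDot hs a φ).mul_left
  rw [integral_place a (hFc.integrable_of_hasCompactSupport hFs)]
  refine integral_congr_ae (ae_of_all _ fun y => ?_)
  have hcy : Continuous fun p => F (place a p y) :=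
    hFc.comp ((continuous_place a).comp (by fun_prop : Continuous fun p : Space => (p, y)))
  have hsy : HasCompactSupport fun p => F (place a p y) := by
    obtain ⟨C, hC⟩ := hFs.isCompact.isBounded.exists_norm_le
    refine HasCompactSupport.intro (isCompact_closedBall (0 : Space) C) fun p hp => ?_
    refine image_eq_zero_of_notMem_tsupport fun hx => hp ?_
    rw [mem_closedBall_zero_iff]
    have := (norm_le_pi_norm (place a p y) a).trans (hC _ hx)
    rwa [place_apply_self] at this
  -- For `r ≤ 0` the profile is locally constant, so the radial integral may run over all of `ℝ`.
  have hderiv : ∀ r ∈ (Set.Ioi (0 : ℝ))ᶜ, ((-deriv κ r : ℝ) : ℂ) * flux f φ a r y = 0 := by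
    intro r hr
    have : κ =ᶠ[𝓝 r] fun _ => 1 := by
      have hr' : r < δ := (Set.notMem_Ioi.1 hr).trans_lt hδ
      filter_upwards [gt_mem_nhds hr'] with s hs using h1 s hs
    rw [this.deriv_eq]
    simp
  simp only
  rw [integral_space_polar (hcy.integrable_of_hasCompactSupport hsy),
    ← setIntegral_eq_integral_of_forall_compl_eq_zero hderiv, ← integral_const_mul]
  refine setIntegral_congr_fun measurableSet_Ioi fun r hr => ?_
  simp only [hF, flux, wronskian, gradDot_radialCutoff hκ hδ h1 _ a hr]
  rw [mul_left_comm (((-deriv κ r : ℝ)) : ℂ), mul_left_comm (radialCutoff κ y),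
    ← mul_assoc (radialCutoff κ y), ← integral_const_mul (radialCutoff κ y * _)]
  refine congrArg _ (integral_congr_ae (ae_of_all _ fun n => ?_))
  push_cast
  ring

/-! ### Profiles whose transition layer collapses -/

/-- A smooth profile that is `1` on `(-∞, R - ε]` and `0` on `[R, ∞)`. -/
noncomputable def profile (R ε r : ℝ) : ℝ := Real.smoothTransition ((R - r) / ε)

section Profile

variable {R ε : ℝ}

theorem contDiff_profile : ContDiff ℝ 1 (profile R ε) :=
  Real.smoothTransition.contDiff (n := 1).comp ((contDiff_const.sub contDiff_id).div_const ε)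

theorem profile_eq_one (hε : 0 < ε) {r : ℝ} (hr : r < R - ε) : profile R ε r = 1 :=
  Real.smoothTransition.one_of_one_le ((one_le_div hε).2 (by linarith))

theorem profile_eq_zero (hε : 0 < ε) {r : ℝ} (hr : R ≤ r) : profile R ε r = 0 :=
  Real.smoothTransition.zero_of_nonpos (div_nonpos_of_nonpos_of_nonneg (by linarith) hε.le)

theorem profile_nonneg (r : ℝ) : 0 ≤ profile R ε r := Real.smoothTransition.nonneg _

theorem profile_le_one (r : ℝ) : profile R ε r ≤ 1 := Real.smoothTransition.le_one _

theorem norm_radialCutoff_profile_le {ι : Type*} [Fintype ι] (x : ι → Space) :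
    ‖radialCutoff (profile R ε) x‖ ≤ 1 := by
  rw [radialCutoff, Complex.norm_real, Real.norm_of_nonneg
    (Finset.prod_nonneg fun b _ => profile_nonneg _)]
  exact Finset.prod_le_one (fun b _ => profile_nonneg _) fun b _ => profile_le_one _

theorem norm_radialCutoff_profile_mul_le {ι : Type*} [Fintype ι] (hR : 0 ≤ R) (hε : 0 < ε)
    {x : ι → Space} {z : ℂ} {C : ℝ} (hz : x ∈ Metric.closedBall (0 : ι → Space) R → ‖z‖ ≤ C) :
    ‖radialCutoff (profile R ε) x * z‖
      ≤ (Metric.closedBall (0 : ι → Space) R).indicator (fun _ => C) x := by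
  by_cases hx : x ∈ Metric.closedBall (0 : ι → Space) R
  · rw [Set.indicator_of_mem hx, norm_mul]
    exact (mul_le_of_le_one_left (norm_nonneg _) (norm_radialCutoff_profile_le x)).trans (hz hx)
  · rw [Set.indicator_of_notMem hx]
    rw [mem_closedBall_zero_iff, pi_norm_le_iff_of_nonneg hR] at hx
    push Not at hx
    obtain ⟨b, hb⟩ := hx
    rw [radialCutoff_eq_zero (fun r hr => profile_eq_zero hε hr) hb.le, zero_mul, norm_zero]

/-- At each point the values are eventually constant. Since the profile vanishes already at `R`, the
limit is the indicator of the open product, with no exceptional boundary points. -/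
theorem tendsto_radialCutoff_profile {ι : Type*} [Fintype ι] (R : ℝ) (x : ι → Space) :
    Tendsto (fun ε => radialCutoff (profile R ε) x) (𝓝[>] 0)
      (𝓝 ({x : ι → Space | ∀ b, ‖x b‖ < R}.indicator (fun _ => (1 : ℂ)) x)) := by
  by_cases hx : ∀ b, ‖x b‖ < R
  · rw [Set.indicator_of_mem (s := {x : ι → Space | ∀ b, ‖x b‖ < R}) hx]
    refine tendsto_const_nhds.congr' ?_
    have h1 : ∀ b, ∀ᶠ ε in 𝓝[>] (0 : ℝ), ε < R - ‖x b‖ := fun b =>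
      nhdsWithin_le_nhds (gt_mem_nhds (by linarith [hx b]))
    filter_upwards [eventually_all.2 h1, self_mem_nhdsWithin] with ε h hε
    rw [radialCutoff, Finset.prod_eq_one fun b _ => profile_eq_one hε (by linarith [h b]),
      Complex.ofReal_one]
  · rw [Set.indicator_of_notMem (s := {x : ι → Space | ∀ b, ‖x b‖ < R}) hx]
    push Not at hx
    obtain ⟨b, hb⟩ := hx
    refine tendsto_const_nhds.congr' ?_
    filter_upwards [self_mem_nhdsWithin] with ε hε
    rw [radialCutoff_eq_zero (fun r hr => profile_eq_zero hε hr) hb]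

theorem deriv_smoothTransition_eq_zero {s : ℝ} (hs : s ∉ Set.Icc (0 : ℝ) 1) :
    deriv Real.smoothTransition s = 0 := by
  rw [Set.mem_Icc, not_and_or, not_le, not_le] at hs
  rcases hs with hs | hs
  · have : Real.smoothTransition =ᶠ[𝓝 s] fun _ => 0 := by
      filter_upwards [gt_mem_nhds hs] with t ht using Real.smoothTransition.zero_of_nonpos ht.le
    rw [this.deriv_eq, deriv_const]
  · have : Real.smoothTransition =ᶠ[𝓝 s] fun _ => 1 := by
      filter_upwards [lt_mem_nhds hs] with t ht using Real.smoothTransition.one_of_one_le ht.le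
    rw [this.deriv_eq, deriv_const]

theorem continuous_deriv_smoothTransition : Continuous (deriv Real.smoothTransition) :=
  (Real.smoothTransition.contDiff (n := 1)).continuous_deriv le_rfl

theorem integral_deriv_smoothTransition :
    ∫ s in Set.Icc (0 : ℝ) 1, deriv Real.smoothTransition s = 1 := by
  rw [integral_Icc_eq_integral_Ioc, ← intervalIntegral.integral_of_le zero_le_one,
    intervalIntegral.integral_deriv_eq_sub
      (fun s _ => (Real.smoothTransition.contDiff (n := 1)).differentiable one_ne_zero s)
      (continuous_deriv_smoothTransition.intervalIntegrable _ _),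
    Real.smoothTransition.one, Real.smoothTransition.zero, sub_zero]

theorem deriv_profile (R ε r : ℝ) :
    deriv (profile R ε) r = -(ε⁻¹ * deriv Real.smoothTransition ((R - r) / ε)) := by
  have h1 : HasDerivAt (fun r : ℝ => (R - r) / ε) (-1 / ε) r :=
    ((hasDerivAt_id r).const_sub R).div_const ε
  have h2 := (((Real.smoothTransition.contDiff (n := 1)).differentiable one_ne_zero
    ((R - r) / ε)).hasDerivAt.comp r h1).deriv
  refine h2.trans ?_
  rw [neg_div, one_div]
  ring

/-- The substitution `s = (R - r) / ε` replaces the concentrating weight by a fixed one of total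
mass `1` on `[0, 1]`; `ε` remains only in the argument of `w`. -/
theorem integral_deriv_profile_mul (R : ℝ) (hε : 0 < ε) (w : ℝ → ℂ) :
    ∫ r, ((-deriv (profile R ε) r : ℝ) : ℂ) * w r
      = ∫ s in Set.Icc (0 : ℝ) 1, ((deriv Real.smoothTransition s : ℝ) : ℂ) * w (R - ε * s) := by
  let G : ℝ → ℂ := fun s => ((deriv Real.smoothTransition s : ℝ) : ℂ) * w (R - ε * s)
  have h1 : ∀ r, ((-deriv (profile R ε) r : ℝ) : ℂ) * w r = ((ε⁻¹ : ℝ) : ℂ) * G ((R - r) / ε) := by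
    intro r
    have : R - ε * ((R - r) / ε) = r := by field_simp; ring
    simp only [G, this, deriv_profile]
    push_cast
    ring
  have h2 : ∀ s ∉ Set.Icc (0 : ℝ) 1, G s = 0 := fun s hs => by
    simp only [G, deriv_smoothTransition_eq_zero hs, Complex.ofReal_zero, zero_mul]
  simp only [h1]
  rw [integral_const_mul, integral_sub_left_eq_self (fun r => G (r / ε)) volume R,
    Measure.integral_comp_div, abs_of_pos hε, Complex.real_smul, ← mul_assoc,
    ← Complex.ofReal_mul, inv_mul_cancel₀ hε.ne', Complex.ofReal_one, one_mul,
    setIntegral_eq_integral_of_forall_compl_eq_zero h2]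

end Profile

/-! ### Green's identity on products of balls -/

theorem isOpen_forall_norm_lt {ι : Type*} [Finite ι] (R : ℝ) :
    IsOpen {x : ι → Space | ∀ b, ‖x b‖ < R} := by
  simp only [Set.ofPred_forall]
  exact isOpen_iInter_of_finite fun b => isOpen_lt (continuous_apply b).norm continuous_const

theorem continuous_wronskian {f φ : Config A → ℂ} (hf : ContDiff ℝ 1 f) (hφ : ContDiff ℝ 1 φ)
    (a : Fin A) : Continuous fun q : Space × Config A => wronskian f φ a q.1 q.2 := by
  have hs : Continuous fun q : Space × Config A => (Pi.single a q.1 : Config A) :=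
    (ContinuousLinearMap.single ℝ (fun _ : Fin A => Space) a).continuous.comp continuous_fst
  have hd : ∀ {h : Config A → ℂ}, ContDiff ℝ 1 h →
      Continuous fun q : Space × Config A => partialDeriv a q.1 h q.2 := fun hh =>
    ((hh.continuous_fderiv one_ne_zero).comp continuous_snd).clm_apply hs
  exact ((hf.continuous.comp continuous_snd).mul (hd hφ)).sub
    ((hd hf).mul (hφ.continuous.comp continuous_snd))

theorem continuous_flux {f φ : Config A → ℂ} (hf : ContDiff ℝ 1 f) (hφ : ContDiff ℝ 1 φ)
    (a : Fin A) : Continuous fun q : ℝ × Others a => flux f φ a q.1 q.2 := by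
  refine (by fun_prop : Continuous fun q : ℝ × Others a => ((q.1 ^ 2 : ℝ) : ℂ)).mul ?_
  have hc : Continuous (Function.uncurry fun (q : ℝ × Others a) (n : Metric.sphere (0 : Space) 1) =>
      wronskian f φ a (n : Space) (place a (q.1 • (n : Space)) q.2)) := by
    refine (continuous_wronskian hf hφ a).comp (Continuous.prodMk (by fun_prop) ?_)
    exact (continuous_place a).comp
      (by fun_prop : Continuous fun p : (ℝ × Others a) × Metric.sphere (0 : Space) 1 =>
        (p.1.1 • (p.2 : Space), p.1.2))
  have h := continuous_parametric_integral_of_continuous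
    (μ := (volume : Measure Space).toSphere) hc isCompact_univ
  simpa only [Measure.restrict_univ] using h

/-- After rescaling, the shell average is jointly continuous in `(ε, y)` up to `ε = 0`, where it
equals the flux at `R`. Its bound on `[0, 1]` times the closed ball dominates the outer integral. -/
theorem tendsto_integral_radialCutoff_flux {f φ : Config A → ℂ} (hf : ContDiff ℝ 1 f)
    (hφ : ContDiff ℝ 1 φ) (a : Fin A) {R : ℝ} (hR : 0 ≤ R) :
    Tendsto (fun ε => ∫ y : Others a, radialCutoff (profile R ε) y *
        ∫ r, ((-deriv (profile R ε) r : ℝ) : ℂ) * flux f φ a r y) (𝓝[>] 0)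
      (𝓝 (∫ y in {y : Others a | ∀ b, ‖y b‖ < R}, flux f φ a R y)) := by
  let I : ℝ × Others a → ℂ := fun q => ∫ s in Set.Icc (0 : ℝ) 1,
    ((deriv Real.smoothTransition s : ℝ) : ℂ) * flux f φ a (R - q.1 * s) q.2
  have hI : Continuous I := by
    have hc : Continuous (Function.uncurry fun (q : ℝ × Others a) (s : ℝ) =>
        ((deriv Real.smoothTransition s : ℝ) : ℂ) * flux f φ a (R - q.1 * s) q.2) := by
      refine Continuous.mul ?_ ?_
      · exact Complex.continuous_ofReal.comp
          (continuous_deriv_smoothTransition.comp continuous_snd)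
      · exact (continuous_flux hf hφ a).comp
          (by fun_prop : Continuous fun p : (ℝ × Others a) × ℝ => (R - p.1.1 * p.2, p.1.2))
    exact continuous_parametric_integral_of_continuous hc isCompact_Icc
  have hI0 : ∀ y, I (0, y) = flux f φ a R y := by
    intro y
    simp only [I, zero_mul, sub_zero]
    rw [integral_mul_const, integral_complex_ofReal, integral_deriv_smoothTransition,
      Complex.ofReal_one, one_mul]
  obtain ⟨C, hC⟩ := ((isCompact_Icc (a := (0 : ℝ)) (b := 1)).prod
    (isCompact_closedBall (0 : Others a) R)).exists_bound_of_continuousOn hI.continuousOn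
  have hmain := tendsto_integral_mul_of_locallyIntegrable (μ := (volume : Measure (Others a)))
    (u := fun _ => 1) (l := 𝓝[>] (0 : ℝ))
    (θ := fun ε y => radialCutoff (profile R ε) y * I (ε, y))
    (η := {y : Others a | ∀ b, ‖y b‖ < R}.indicator fun y => flux f φ a R y)
    (K := Metric.closedBall 0 R) (C := C)
    continuous_const.locallyIntegrable (isCompact_closedBall _ _) ?_
    aestronglyMeasurable_const ?_ ?_
  · simp only [one_mul] at hmain
    rw [integral_indicator (isOpen_forall_norm_lt R).measurableSet] at hmain
    refine hmain.congr' ?_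
    filter_upwards [self_mem_nhdsWithin] with ε hε
    simp only [integral_deriv_profile_mul R hε, I]
  · refine .of_forall fun ε => Continuous.aestronglyMeasurable (Continuous.mul ?_ ?_)
    · exact Complex.continuous_ofReal.comp (continuous_finsetProd _ fun b _ =>
        contDiff_profile.continuous.comp (continuous_apply b).norm)
    · exact hI.comp (by fun_prop : Continuous fun y : Others a => (ε, y))
  · filter_upwards [self_mem_nhdsWithin, nhdsWithin_le_nhds (gt_mem_nhds one_pos)] with ε hε hε1 y
    exact norm_radialCutoff_profile_mul_le hR hε fun hy =>
      hC _ ⟨⟨(Set.mem_Ioi.1 hε).le, le_of_lt hε1⟩, hy⟩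
  · intro y
    have h1 : Tendsto (fun ε : ℝ => I (ε, y)) (𝓝[>] 0) (𝓝 (flux f φ a R y)) := by
      rw [← hI0]
      exact (((hI.comp (by fun_prop : Continuous fun ε : ℝ => (ε, y))).tendsto 0)).mono_left
        nhdsWithin_le_nhds
    convert (tendsto_radialCutoff_profile R y).mul h1 using 2
    by_cases hy : y ∈ {y : Others a | ∀ b, ‖y b‖ < R} <;> simp only [Set.indicator_of_mem,
      Set.indicator_of_notMem, hy, not_false_eq_true, one_mul, zero_mul]

/-- Green's identity on the product of balls `{x | ∀ b, |x_b| < R}`. -/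
theorem IsSchrodingerViolation.sum_flux {m : Fin A → ℝ} {V : Config A → ℝ} {E : ℝ}
    (hV : LocallyIntegrable V volume) {f φ gf gφ : Config A → ℂ}
    (hf : IsSchrodingerViolation m V E f gf) (hφ : IsSchrodingerViolation m V E φ gφ)
    {R : ℝ} (hR : 0 < R) :
    ∑ a : Fin A, ((1 / (2 * m a) : ℝ) : ℂ) *
        ∫ y in {y : Others a | ∀ b, ‖y b‖ < R}, flux f φ a R y
      = ∫ x in {x : Config A | ∀ b, ‖x b‖ < R}, (gφ x * f x - gf x * φ x) := by
  have h1 := tendsto_finsetSum Finset.univ fun a _ =>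
    (tendsto_integral_radialCutoff_flux hf.1 hφ.1 a hR.le).const_mul ((1 / (2 * m a) : ℝ) : ℂ)
  have hu : LocallyIntegrable (fun x => gφ x * f x - gf x * φ x) volume :=
    (hφ.2.1.smul_continuous hf.1.continuous).sub (hf.2.1.smul_continuous hφ.1.continuous)
  have h2 := tendsto_integral_mul_of_locallyIntegrable hu (l := 𝓝[>] (0 : ℝ))
    (θ := fun ε x => radialCutoff (profile R ε) x)
    (η := {x : Config A | ∀ b, ‖x b‖ < R}.indicator fun _ => 1)
    (K := Metric.closedBall 0 R) (C := 1) (isCompact_closedBall _ _)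
    (.of_forall fun ε => Continuous.aestronglyMeasurable (Complex.continuous_ofReal.comp
      (continuous_finsetProd _ fun b _ =>
        contDiff_profile.continuous.comp (continuous_apply b).norm)))
    hu.aestronglyMeasurable
    (by
      filter_upwards [self_mem_nhdsWithin] with ε hε x
      simpa using norm_radialCutoff_profile_mul_le (z := 1) (C := 1) hR.le hε (x := x)
        fun _ => by simp)
    (tendsto_radialCutoff_profile R)
  have h3 : ∫ x, (gφ x * f x - gf x * φ x) *
      {x : Config A | ∀ b, ‖x b‖ < R}.indicator (fun _ => 1) x
      = ∫ x in {x : Config A | ∀ b, ‖x b‖ < R}, (gφ x * f x - gf x * φ x) := by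
    rw [← integral_indicator (isOpen_forall_norm_lt R).measurableSet]
    refine integral_congr_ae (ae_of_all _ fun x => ?_)
    by_cases hx : x ∈ {x : Config A | ∀ b, ‖x b‖ < R} <;> simp only [Set.indicator_of_mem,
      Set.indicator_of_notMem, hx, not_false_eq_true, mul_one, mul_zero]
  rw [h3] at h2
  refine tendsto_nhds_unique (h1.congr' ?_) h2
  -- `ε < R` makes the profile equal to `1` near the origin, as smoothness of the cutoff requires.
  filter_upwards [self_mem_nhdsWithin, nhdsWithin_le_nhds (gt_mem_nhds hR)] with ε hε hεR
  have hδ : 0 < R - ε := sub_pos.2 hεR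
  have hone : ∀ r < R - ε, profile R ε r = 1 := fun r hr => profile_eq_one hε hr
  have hzero : ∀ r, R ≤ r → profile R ε r = 0 := fun r hr => profile_eq_zero hε hr
  rw [← hf.green hV hφ (contDiff_radialCutoff contDiff_profile hδ hone)
    (hasCompactSupport_radialCutoff hR.le hzero)]
  refine Finset.sum_congr rfl fun a _ => ?_
  rw [integral_current_radialCutoff contDiff_profile hδ hone hR.le hzero hf.1 hφ.1]

/-! ### Exhaustion by products of balls -/

theorem aecover_forall_norm_lt {ι : Type*} [Fintype ι] (μ : Measure (ι → Space)) :
    AECover μ (atTop : Filter ℝ) fun R => {x : ι → Space | ∀ b, ‖x b‖ < R} where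
  ae_eventually_mem := ae_of_all _ fun _ => eventually_all.2 fun _ => eventually_gt_atTop _
  measurableSet R := (isOpen_forall_norm_lt R).measurableSet

/-- If the functions `s R` converge pointwise a.e. and are dominated on the growing products of
balls, then the limit is integrable and is the limit of the integrals over these products. -/
theorem integrable_and_tendsto_of_dominated {ι : Type*} [Fintype ι] {μ : Measure (ι → Space)}
    {s : ℝ → (ι → Space) → ℂ} {w : (ι → Space) → ℂ} {h : (ι → Space) → ℝ}
    (hs : ∀ R, AEStronglyMeasurable (s R) μ)
    (hlim : ∀ᵐ y ∂μ, Tendsto (fun R => s R y) atTop (𝓝 (w y))) (hh : Integrable h μ)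
    (hb : ∀ᶠ R : ℝ in atTop, ∀ᵐ y ∂μ, (∀ b, ‖y b‖ < R) → ‖s R y‖ ≤ h y) :
    Integrable w μ ∧
      Tendsto (fun R : ℝ => ∫ y in {y : ι → Space | ∀ b, ‖y b‖ < R}, s R y ∂μ) atTop
        (𝓝 (∫ y, w y ∂μ)) := by
  let B : ℝ → Set (ι → Space) := fun R => {y | ∀ b, ‖y b‖ < R}
  have hB : ∀ R, MeasurableSet (B R) := fun R => (isOpen_forall_norm_lt R).measurableSet
  have hmeas : ∀ R, AEStronglyMeasurable ((B R).indicator (s R)) μ := fun R =>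
    (hs R).indicator (hB R)
  have hlim' : ∀ᵐ y ∂μ, Tendsto (fun R => (B R).indicator (s R) y) atTop (𝓝 (w y)) := by
    filter_upwards [hlim] with y hy
    refine hy.congr' ?_
    have hmem : ∀ᶠ R : ℝ in atTop, ∀ b, ‖y b‖ < R :=
      eventually_all.2 fun b => eventually_gt_atTop _
    filter_upwards [hmem] with R hR
    exact (Set.indicator_of_mem (s := B R) hR _).symm
  -- Outside `B R` nothing forces `h y ≥ 0`, hence the absolute value.
  have hb' : ∀ᶠ R : ℝ in atTop, ∀ᵐ y ∂μ, ‖(B R).indicator (s R) y‖ ≤ |h y| := by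
    filter_upwards [hb] with R hR
    filter_upwards [hR] with y hy
    by_cases hyB : y ∈ B R
    · rw [Set.indicator_of_mem hyB]
      exact (hy hyB).trans (le_abs_self _)
    · rw [Set.indicator_of_notMem hyB, norm_zero]
      exact abs_nonneg _
  constructor
  · have hwm : AEStronglyMeasurable w μ := aestronglyMeasurable_of_tendsto_ae atTop hmeas hlim'
    refine hh.abs.mono' hwm ?_
    -- The null set in the bound depends on `R`; along integer radii only countably many must be
    -- united.
    have hN : ∀ᶠ n : ℕ in atTop, ∀ᵐ y ∂μ, ‖(B n).indicator (s n) y‖ ≤ |h y| :=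
      tendsto_natCast_atTop_atTop.eventually hb'
    obtain ⟨N, hN⟩ := eventually_atTop.1 hN
    have hall : ∀ᵐ y ∂μ, ∀ n : ℕ, N ≤ n → ‖(B n).indicator (s n) y‖ ≤ |h y| :=
      ae_all_iff.2 fun n => by
        by_cases hn : N ≤ n
        · filter_upwards [hN n hn] with y hy _ using hy
        · exact ae_of_all _ fun y h => absurd h hn
    filter_upwards [hlim', hall] with y hy hy'
    exact le_of_tendsto (hy.comp tendsto_natCast_atTop_atTop).norm
      (eventually_atTop.2 ⟨N, fun n hn => hy' n hn⟩)
  · refine (tendsto_integral_filter_of_dominated_convergence (fun y => |h y|)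
      (.of_forall hmeas) hb' hh.abs hlim').congr fun R => ?_
    exact integral_indicator (hB R)

/-! ### Boundary terms at infinity -/

theorem continuous_surfaceTerm {A : ℕ} {ξ φ : Config A → ℂ} (hξ : ContDiff ℝ 1 ξ)
    (hφ : ContDiff ℝ 1 φ) (a : Fin A) (R : ℝ) : Continuous (surfaceTerm ξ φ a R) := by
  have h := (continuous_flux (Complex.conjCLE.contDiff.comp hξ) hφ a).comp
    (by fun_prop : Continuous fun y : Others a => (R, y))
  exact h.congr fun y => (surfaceTerm_eq_flux hξ φ a R y).symm

/-- The total boundary term over the product of balls of radius `R` is a volume integral. -/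
theorem IsEigenstate.sum_surfaceTerm {A : ℕ} {m : Fin A → ℝ} {V : Config A → ℝ} {E : ℝ}
    (hV : LocallyIntegrable V volume) {ξ φ g : Config A → ℂ} (hξ : IsEigenstate m V E ξ)
    (hφ : IsSchrodingerViolation m V E φ g) (M : ℝ) {R : ℝ} (hR : 0 < R) :
    ∑ a : Fin A, ((M / m a : ℝ) : ℂ) *
        ∫ y in {y : Others a | ∀ b, ‖y b‖ < R}, surfaceTerm ξ φ a R y
      = ((2 * M : ℝ) : ℂ) * ∫ x in {x : Config A | ∀ b, ‖x b‖ < R}, g x * conj (ξ x) := by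
  have h := IsSchrodingerViolation.sum_flux hV (IsSchrodingerViolation.conj hξ) hφ hR
  simp only [map_zero, zero_mul, sub_zero] at h
  rw [← h, Finset.mul_sum]
  refine Finset.sum_congr rfl fun a _ => ?_
  simp only [surfaceTerm_eq_flux hξ.1]
  rw [← mul_assoc, ← Complex.ofReal_mul]
  -- `M / m a = 2 * M * (1 / (2 * m a))`, the source of the factor `2` in the bound.
  congr 2
  rw [one_div, mul_inv, div_eq_mul_inv]
  ring

end ManyBody

theorem mainTheorem12 {A : ℕ} (m : Fin A → ℝ) (hm : ∀ a, 0 < m a) (M : ℝ) (hM : 0 < M)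
    (V : ManyBody.Config A → ℝ) (hV : ManyBody.IsLocalPotential V) (E : ℝ)
    (ξ ψ ψ' g : ManyBody.Config A → ℂ)
    (hξ : ManyBody.IsEigenstate m V E ξ) (hξb : BddAbove (Set.range fun x => ‖ξ x‖))
    (hψ : ManyBody.IsEigenstate m V E ψ)
    (hψ' : ManyBody.IsSchrodingerViolation m V E ψ' g) (hg : Integrable g volume) :
    ∃ L : ℂ,
      Tendsto (fun R : ℝ => ∑ a : Fin A, ((M / m a : ℝ) : ℂ) *
          ∫ y in {y : ManyBody.Others a | ∀ b, ‖y b‖ < R},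
            ManyBody.surfaceTerm ξ (fun x => ψ' x - ψ x) a R y) atTop (𝓝 L) ∧
      ‖L‖ ≤ 2 * M * (⨆ x, ‖ξ x‖) * ∫ x, ‖g x‖ ∧
      ∀ (w : (a : Fin A) → ManyBody.Others a → ℂ) (h : (a : Fin A) → ManyBody.Others a → ℝ),
        (∀ a, ∀ᵐ y : ManyBody.Others a, Tendsto (fun R : ℝ =>
          ManyBody.surfaceTerm ξ (fun x => ψ' x - ψ x) a R y) atTop (𝓝 (w a y))) →
        (∀ a, Integrable (h a) volume) →
        (∀ a, ∀ᶠ R : ℝ in atTop, ∀ᵐ y : ManyBody.Others a, (∀ b, ‖y b‖ < R) →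
          ‖ManyBody.surfaceTerm ξ (fun x => ψ' x - ψ x) a R y‖ ≤ h a y) →
        (∀ a, Integrable (w a) volume) ∧
          ∑ a : Fin A, ((M / m a : ℝ) : ℂ) * ∫ y, w a y = L ∧
          ‖∑ a : Fin A, ((M / m a : ℝ) : ℂ) * ∫ y, w a y‖
            ≤ 2 * M * (⨆ x, ‖ξ x‖) * ∫ x, ‖g x‖ := by
  have hVl := hV.locallyIntegrable
  have hφ : ManyBody.IsSchrodingerViolation m V E (fun x => ψ' x - ψ x) g := by
    simpa only [sub_zero] using hψ'.sub hVl hψ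
  have hnorm : ∀ x, ‖ξ x‖ ≤ ⨆ x, ‖ξ x‖ := fun x => le_ciSup hξb x
  have hint : Integrable (fun x => g x * conj (ξ x)) volume :=
    hg.mul_bdd (c := ⨆ x, ‖ξ x‖)
      (Complex.continuous_conj.comp hξ.1.continuous).aestronglyMeasurable
      (ae_of_all _ fun x => by rw [RCLike.norm_conj]; exact hnorm x)
  have hbound : ‖((2 * M : ℝ) : ℂ) * ∫ x, g x * conj (ξ x)‖
      ≤ 2 * M * (⨆ x, ‖ξ x‖) * ∫ x, ‖g x‖ := by
    rw [norm_mul, Complex.norm_real, Real.norm_of_nonneg (by positivity), mul_assoc (2 * M)]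
    refine mul_le_mul_of_nonneg_left ?_ (by positivity)
    rw [← integral_const_mul]
    refine norm_integral_le_of_norm_le (hg.norm.const_mul _) (ae_of_all _ fun x => ?_)
    rw [norm_mul, RCLike.norm_conj, mul_comm]
    exact mul_le_mul_of_nonneg_right (hnorm x) (norm_nonneg _)
  have hL : Tendsto (fun R : ℝ => ∑ a : Fin A, ((M / m a : ℝ) : ℂ) *
      ∫ y in {y : ManyBody.Others a | ∀ b, ‖y b‖ < R},
        ManyBody.surfaceTerm ξ (fun x => ψ' x - ψ x) a R y) atTop
      (𝓝 (((2 * M : ℝ) : ℂ) * ∫ x, g x * conj (ξ x))) := by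
    refine (((ManyBody.aecover_forall_norm_lt (volume : Measure (ManyBody.Config A))).integral_tendsto_of_countably_generated
      hint).const_mul ((2 * M : ℝ) : ℂ)).congr' ?_
    filter_upwards [eventually_gt_atTop 0] with R hR
    exact (ManyBody.IsEigenstate.sum_surfaceTerm hVl hξ hφ M hR).symm
  refine ⟨_, hL, hbound, fun w h hw hh hdom => ?_⟩
  have hlim := fun a => ManyBody.integrable_and_tendsto_of_dominated
    (fun R => (ManyBody.continuous_surfaceTerm hξ.1 hφ.1 a R).aestronglyMeasurable)
    (hw a) (hh a) (hdom a)
  -- The same finite-radius sums converge to both sides.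
  have heq : ∑ a : Fin A, ((M / m a : ℝ) : ℂ) * ∫ y, w a y
      = ((2 * M : ℝ) : ℂ) * ∫ x, g x * conj (ξ x) :=
    tendsto_nhds_unique (tendsto_finsetSum _ fun a _ => (hlim a).2.const_mul _) hL
  exact ⟨fun a => (hlim a).1, heq, heq ▸ hbound⟩
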